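/- Let $\mathcal X$ be a separable metric space with its Borel $\sigma$-algebra, $\mathcal Y\subseteq\mathbb R$ closed, and let $\mathcal X=\mathcal X_1\cup\dots\cup\mathcal X_B$, where the regions $\mathcal X_b$ may overlap and each $\mathcal X_b$ is a complete (separable) metric space. Let $w_b:\mathcal X\to[0,1]$ be measurable weights with $\sum_{b=1}^B w_b(x)=1$ for all $x\in\mathcal X$ and $w_b(x)=0$ for $x\notin\mathcal X_b$, and let $\lambda_1,\dots,\lambda_B>0$. For every $b$ let $H_b$ be the reproducing kernel Hilbert space of a bounded and continuous kernel $k_b$ on $\mathcal X_b$. Let $L:\mathcal Y\times\mathbb R\to[0,\infty)$ be a measurable loss function that is convex in its last argument and Lipschitz continuous in its last argument with constant $|L|_1$ (uniformly in $y$), such that $L(y,\cdot)$ is twice continuously differentiable for every $y\in\mathcal Y$, with derivatives $L'(y,\cdot)$, $L''(y,\cdot)$ satisfying $\sup_{y\in\mathcal Y}\sup_{t\in\mathbb R}|L'(y,t)|\in(0,\infty)$ and $\sup_{y\in\mathcal Y}\sup_{t\in\mathbb R}|L''(y,t)|<\infty$. For a probability measure $\nu$ on $\mathcal X_b\times\mathcal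 Y$ let $S_b(\nu)$ be the local support vector machine, i.e. the minimizer over $f\in H_b$ of $$\int \big(L(y,f(x))-L(y,0)\big)\,d\nu(x,y)+\lambda_b\|f\|_{H_b}^2 ,$$ which exists and is unique; if $\nu$ is not a probability measure, let $S_b(\nu)$ be an arbitrary measurable function on $\mathcal X_b$. For a probability measure $P$ on $\mathcal X\times\mathcal Y$ with marginal $P^X$ on $\mathcal X$, let $P_b$ be $P(\mathcal X_b\times\mathcal Y)^{-1}$ times the restriction of $P$ to $\mathcal X_b\times\mathcal Y$ if $P(\mathcal X_b\times\mathcal Y)>0$, and the null measure otherwise. For $z\in\mathcal X\times\mathcal Y$ and $\varepsilon\in(0,1]$ put $$\tilde P_{b,\varepsilon,z}:=\begin{cases}(1-\varepsilon)P_b+\varepsilon\delta_z & \text{if } z\in\mathcal X_b\times\mathcal Y,\\ P_b&\text{otherwise.}\end{cases}$$ The composed predictor under $P$ is $f^{comp}_P:=\sum_{b=1}^B w_b\,S_b(P_b)$, and the composed predictor under contamination of $P$ at $z$ with weight $\varepsilon$ is $f^{comp}_{P,\varepsilon,z}:=\sum_{b=1}^B w_b\,S_b(\tilde P_{b,\varepsilon,z})$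 (the summands being $0$ outside $\mathcal X_b$). Then for all $P$ and all $z$ these predictors belong to $L^\infty(P^X)$, the influence function of the composed predictor $$\mathrm{IF}^{comp}(\delta_z;S,P):=\lim_{\varepsilon\downarrow0}\frac{f^{comp}_{P,\varepsilon,z}-f^{comp}_P}{\varepsilon}$$ exists as a limit in $L^\infty(P^X)$, and $$\|\mathrm{IF}^{comp}(\delta_z;S,P)\|_{L^\infty(P^X)}\le 2\,|L|_1\sum_{b=1}^B\Big(\sup_{x\in\mathcal X_b}w_b(x)\Big)\,\lambda_b^{-1}\,\Big(\sup_{x\in\mathcal X_b}\sqrt{k_b(x,x)}\Big)^2 .$$ In particular the bound does not depend on $z$ or $P$. -/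

import Mathlib

open MeasureTheory Filter Topology Set
open scoped ENNReal NNReal

noncomputable section

namespace LocalSVM

/-- The scalar reproducing kernel `k(x, x')` of a real reproducing kernel Hilbert space `H` of
functions on `E`; here Mathlib's operator-valued kernel acts on the one-dimensional space `ℝ`. -/
def scalarKernel {E : Type*} (H : Type*) [NormedAddCommGroup H] [InnerProductSpace ℝ H]
    [CompleteSpace H] [RKHS ℝ H E ℝ] (x x' : E) : ℝ :=
  RKHS.kernel H x x' 1

/-- The sup-norm `sup_x √(k(x, x))` of the kernel of `H`. -/
def kernelNorm {E : Type*} (H : Type*) [NormedAddCommGroup H] [InnerProductSpace ℝ H]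
    [CompleteSpace H] [RKHS ℝ H E ℝ] : ℝ :=
  ⨆ x : E, √(scalarKernel H x x)

/-- The shifted loss `L*(y, t) = L(y, t) - L(y, 0)`. -/
def shiftedLoss {Y : Type*} (L : Y → ℝ → ℝ) (y : Y) (t : ℝ) : ℝ :=
  L y t - L y 0

/-- The regularized risk `∫ L*(y, f(x)) dν(x, y) + lam ‖f‖²` of an element `f` of `H`. -/
def regRisk {E Y H : Type*} [MeasurableSpace E] [MeasurableSpace Y]
    [NormedAddCommGroup H] [InnerProductSpace ℝ H] [RKHS ℝ H E ℝ]
    (L : Y → ℝ → ℝ) (lam : ℝ) (ν : Measure (E × Y)) (f : H) : ℝ :=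
  (∫ p, shiftedLoss L p.2 (f p.1) ∂ν) + lam * ‖f‖ ^ 2

/-- `f` is a support vector machine for the shifted loss, the law `ν` and the regularization
parameter `lam`: it minimizes the regularized risk over `H`. -/
def IsSVM {E Y H : Type*} [MeasurableSpace E] [MeasurableSpace Y]
    [NormedAddCommGroup H] [InnerProductSpace ℝ H] [RKHS ℝ H E ℝ]
    (L : Y → ℝ → ℝ) (lam : ℝ) (ν : Measure (E × Y)) (f : H) : Prop :=
  ∀ g : H, regRisk L lam ν f ≤ regRisk L lam ν g

/-- `f` is a local predictor for `ν`: an SVM if `ν` is a probability measure, and an arbitrary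
measurable function otherwise. -/
def IsLocalPredictor {E Y : Type*} (H : Type*) [MeasurableSpace E] [MeasurableSpace Y]
    [NormedAddCommGroup H] [InnerProductSpace ℝ H] [RKHS ℝ H E ℝ]
    (L : Y → ℝ → ℝ) (lam : ℝ) (ν : Measure (E × Y)) (f : E → ℝ) : Prop :=
  (IsProbabilityMeasure ν → ∃ h : H, IsSVM L lam ν h ∧ f = h) ∧
    (¬ IsProbabilityMeasure ν → Measurable f)

/-- The regional law on `R × Y`: `P` restricted to `R × Y` and normalized if `P(R × Y) > 0`,
and the null measure otherwise. -/
def regionalLaw {X Y : Type*} [MeasurableSpace X] [MeasurableSpace Y]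
    (P : Measure (X × Y)) (R : Set X) : Measure (R × Y) :=
  open Classical in
  if 0 < P (R ×ˢ univ) then
    (P (R ×ˢ univ))⁻¹ • P.comap (Prod.map (Subtype.val : R → X) (id : Y → Y))
  else 0

/-- The regional law contaminated at `z` with weight `ε`: the mixture
`(1 - ε) P_R + ε δ_z` if `z ∈ R × Y`, and the regional law `P_R` itself otherwise. -/
def contaminatedLaw {X Y : Type*} [MeasurableSpace X] [MeasurableSpace Y]
    (P : Measure (X × Y)) (R : Set X) (z : X × Y) (ε : ℝ) : Measure (R × Y) :=
  open Classical in
  if hz : z.1 ∈ R then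
    ENNReal.ofReal (1 - ε) • regionalLaw P R +
      ENNReal.ofReal ε • Measure.dirac ((⟨z.1, hz⟩ : R), z.2)
  else regionalLaw P R

/-- The composed predictor `x ↦ ∑_b w_b(x) f_b(x)`. The local predictor `f_b` is only defined on
the region `R b`; it is extended by `0`, which is immaterial as `w_b` vanishes off `R b`. -/
def composed {X : Type*} {B : ℕ} {R : Fin B → Set X} (w : Fin B → X → ℝ)
    (f : ∀ b, R b → ℝ) (x : X) : ℝ :=
  ∑ b, w b x * Function.extend (Subtype.val : R b → X) (f b) 0 x

/-- The composed predictor under `P`, where `S b` is the local statistical operator on the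
region `R b`. -/
def composedPredictor {X Y : Type*} [MeasurableSpace X] [MeasurableSpace Y] {B : ℕ}
    {R : Fin B → Set X} (w : Fin B → X → ℝ) (S : ∀ b, Measure (R b × Y) → R b → ℝ)
    (P : Measure (X × Y)) : X → ℝ :=
  composed w fun b => S b (regionalLaw P (R b))

/-- The composed predictor under contamination of `P` at `z` with weight `ε`: every region learns
from its contaminated regional law. -/
def contaminatedPredictor {X Y : Type*} [MeasurableSpace X] [MeasurableSpace Y] {B : ℕ}
    {R : Fin B → Set X} (w : Fin B → X → ℝ) (S : ∀ b, Measure (R b × Y) → R b → ℝ)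
    (P : Measure (X × Y)) (z : X × Y) (ε : ℝ) : X → ℝ :=
  composed w fun b => S b (contaminatedLaw P (R b) z ε)

/-- `G` is (a representative of) the influence function of the composed predictor at `z` for `P`:
the limit of `(contaminated predictor - predictor) / ε` in `L^∞(P^X)` as `ε` decreases to `0`. -/
def IsInfluenceFunction {X Y : Type*} [MeasurableSpace X] [MeasurableSpace Y] {B : ℕ}
    {R : Fin B → Set X} (w : Fin B → X → ℝ) (S : ∀ b, Measure (R b × Y) → R b → ℝ)
    (P : Measure (X × Y)) (z : X × Y) (G : X → ℝ) : Prop :=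
  MemLp G ∞ P.fst ∧
    Tendsto (fun ε : ℝ => eLpNorm (fun x =>
        (contaminatedPredictor w S P z ε x - composedPredictor w S P x) / ε - G x) ∞ P.fst)
      (𝓝[>] 0) (𝓝 0)

end LocalSVM

end

/-! On one region the SVM for `ν` satisfies ∫ L'(y, f) h dν + 2 lam ⟨f, h⟩ = 0 for all h in H.
Writing this for `ν` and for (1 - ε) ν + ε δ_z and testing the difference with h = f_ε - f₀,
monotonicity of L' gives ‖f_ε - f₀‖ ≤ ε ℓ κ / lam, where κ bounds √k(x, x)
(`IsSVM.norm_mixture_sub_le`).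

Differentiating the contaminated equation formally at ε = 0 gives a linear equation for the
derivative g, with form 2 lam ⟨g, h⟩ + ∫ L''(y, f₀) g h dν. The form is coercive since L'' ≥ 0, so
Lax-Milgram yields g (`exists_linearized_solution`). Testing with r = (f_ε - f₀) / ε - g bounds ‖r‖
by a mean linearization error of L', which vanishes by dominated convergence, plus a term of order ε
(`norm_quotient_sub_le`, `tendsto_integral_linearization`). So the quotients converge in H, hence
uniformly on the region, to a limit bounded by ℓ κ² / lam.

Regions of mass zero are invisible in L^∞(P^X); the other finitely many limits are summed with the
weights. The argument yields the bound without the factor 2. -/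

namespace LocalSVM

/-! ### Minimizers of a convex function plus a squared Hilbert norm. -/

section Minimizer

variable {H : Type*} [NormedAddCommGroup H] [InnerProductSpace ℝ H]

/-- The midpoint inequality for a convex function plus a multiple of the squared norm. -/
lemma midpoint_add_sq_le {φ : H → ℝ} (hφ : ConvexOn ℝ univ φ) (lam : ℝ) (f g : H) :
    φ ((1 / 2 : ℝ) • (f + g)) + lam * ‖(1 / 2 : ℝ) • (f + g)‖ ^ 2 + lam / 4 * ‖f - g‖ ^ 2 ≤
      ((φ f + lam * ‖f‖ ^ 2) + (φ g + lam * ‖g‖ ^ 2)) / 2 := by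
  have h1 := hφ.2 (mem_univ f) (mem_univ g) (by norm_num : (0 : ℝ) ≤ 1 / 2)
    (by norm_num : (0 : ℝ) ≤ 1 / 2) (by norm_num)
  rw [← smul_add, smul_eq_mul, smul_eq_mul] at h1
  have h2 : ‖(1 / 2 : ℝ) • (f + g)‖ ^ 2 = ‖f + g‖ ^ 2 / 4 := by
    rw [norm_smul, mul_pow]; norm_num; ring
  have h3 := parallelogram_law_with_norm ℝ f g
  rw [h2]
  have h4 : lam * (‖f + g‖ ^ 2 + ‖f - g‖ ^ 2) = lam * (2 * (‖f‖ ^ 2 + ‖g‖ ^ 2)) := by rw [h3]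
  linarith

/-- A convex Lipschitz function plus a positive multiple of the squared norm has a unique
minimizer on a Hilbert space. -/
theorem existsUnique_forall_add_sq_le [CompleteSpace H] {φ : H → ℝ} (hφ : ConvexOn ℝ univ φ)
    {K : ℝ≥0} (hK : LipschitzWith K φ) {lam : ℝ} (hlam : 0 < lam) :
    ∃! f : H, ∀ g, φ f + lam * ‖f‖ ^ 2 ≤ φ g + lam * ‖g‖ ^ 2 := by
  set J : H → ℝ := fun f => φ f + lam * ‖f‖ ^ 2 with hJ
  have hJc : Continuous J := hK.continuous.add (by fun_prop)
  have hbdd : BddBelow (range J) := by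
    -- Completing the square: lam t² - K t ≥ -K² / (4 lam), with equality at t = K / (2 lam).
    refine ⟨φ 0 - K ^ 2 / (4 * lam), ?_⟩
    rintro _ ⟨f, rfl⟩
    have h1 := hK.dist_le_mul f 0
    rw [Real.dist_eq, dist_zero_right] at h1
    have h2 := (abs_le.1 h1).1
    have h3 : K ^ 2 / (4 * lam) = lam * (K / (2 * lam)) ^ 2 := by field_simp; norm_num
    have h4 : lam * (‖f‖ - K / (2 * lam)) ^ 2 =
        lam * ‖f‖ ^ 2 - K * ‖f‖ + lam * (K / (2 * lam)) ^ 2 := by field_simp; ring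
    have h5 : 0 ≤ lam * (‖f‖ - K / (2 * lam)) ^ 2 := by positivity
    simp only [hJ]
    linarith
  set m := ⨅ f, J f with hm
  have hle : ∀ f, m ≤ J f := fun f => ciInf_le hbdd f
  -- Distances are controlled by the excess over the infimum. This makes minimizing sequences Cauchy
  -- and also gives uniqueness.
  have hdist : ∀ f g, lam / 4 * ‖f - g‖ ^ 2 ≤ (J f + J g) / 2 - m := fun f g => by
    have h1 := midpoint_add_sq_le hφ lam f g
    have h2 := hle ((1 / 2 : ℝ) • (f + g))
    simp only [hJ] at h2 ⊢
    linarith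
  have hseq : ∀ n : ℕ, ∃ f, J f < m + 1 / (n + 1) := fun n =>
    exists_lt_of_ciInf_lt (lt_add_of_pos_right _ (by positivity))
  choose u hu using hseq
  have hlim : Tendsto (fun n : ℕ => √(4 / lam * (1 / ((n : ℝ) + 1)))) atTop (𝓝 0) := by
    have := ((tendsto_one_div_add_atTop_nhds_zero_nat (𝕜 := ℝ)).const_mul (4 / lam)).sqrt
    simpa using this
  have hcauchy : CauchySeq u := by
    refine cauchySeq_of_le_tendsto_0' _ (fun n k hnk => ?_) hlim
    rw [dist_eq_norm]
    refine Real.le_sqrt_of_sq_le ?_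
    have h1 := hdist (u n) (u k)
    have h2 : 1 / ((k : ℝ) + 1) ≤ 1 / ((n : ℝ) + 1) := by gcongr
    have h3 := hu n
    have h4 := hu k
    have h5 : lam / 4 * ‖u n - u k‖ ^ 2 ≤ 1 / ((n : ℝ) + 1) := by linarith
    calc ‖u n - u k‖ ^ 2 = 4 / lam * (lam / 4 * ‖u n - u k‖ ^ 2) := by field_simp
      _ ≤ _ := by gcongr
  obtain ⟨f, hf⟩ := cauchySeq_tendsto_of_complete hcauchy
  have hfm : J f ≤ m := by
    have h1 : Tendsto (fun n : ℕ => m + 1 / ((n : ℝ) + 1)) atTop (𝓝 (m + 0)) :=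
      tendsto_const_nhds.add tendsto_one_div_add_atTop_nhds_zero_nat
    rw [add_zero] at h1
    exact le_of_tendsto_of_tendsto' ((hJc.tendsto f).comp hf) h1 fun n => (hu n).le
  refine ⟨f, fun g => hfm.trans (hle g), fun g hg => ?_⟩
  have h1 := hdist g f
  have h2 : J g ≤ J f := hg f
  have h3 : lam / 4 * ‖g - f‖ ^ 2 ≤ 0 := by linarith
  have h4 : ‖g - f‖ ^ 2 ≤ 0 := by
    by_contra h
    have : 0 < lam / 4 * ‖g - f‖ ^ 2 := mul_pos (by positivity) (not_le.1 h)
    linarith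
  have h5 : ‖g - f‖ = 0 := by nlinarith [norm_nonneg (g - f)]
  exact sub_eq_zero.1 (norm_eq_zero.1 h5)

end Minimizer

/-! ### Point evaluation and continuity in a reproducing kernel Hilbert space. -/

section Evaluation

/-- A map into an inner product space is continuous if its Gram kernel is. -/
lemma continuous_of_continuous_inner {E F : Type*} [TopologicalSpace E] [NormedAddCommGroup F]
    [InnerProductSpace ℝ F] {Φ : E → F} (h : Continuous fun p : E × E => inner ℝ (Φ p.1) (Φ p.2)) :
    Continuous Φ := by
  refine continuous_iff_continuousAt.2 fun x₀ => ?_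
  rw [ContinuousAt, tendsto_iff_norm_sub_tendsto_zero]
  have ha : Continuous fun x : E => inner ℝ (Φ x) (Φ x) :=
    h.comp (continuous_id.prodMk continuous_id)
  have hb : Continuous fun x : E => inner ℝ (Φ x) (Φ x₀) :=
    h.comp (continuous_id.prodMk continuous_const)
  -- This is ‖Φ x - Φ x₀‖² expanded through the Gram kernel.
  have h2 : Continuous fun x : E =>
      inner ℝ (Φ x) (Φ x) - 2 * inner ℝ (Φ x) (Φ x₀) + ‖Φ x₀‖ ^ 2 :=
    (ha.sub (continuous_const.mul hb)).add continuous_const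
  have h3 := h2.sqrt.tendsto x₀
  simp_rw [real_inner_self_eq_norm_sq, ← norm_sub_sq_real, Real.sqrt_sq (norm_nonneg _)] at h3
  have h4 : ‖Φ x₀‖ ^ 2 - 2 * ‖Φ x₀‖ ^ 2 + ‖Φ x₀‖ ^ 2 = 0 := by ring
  simpa [h4] using h3

variable {E : Type*} {H : Type*} [NormedAddCommGroup H] [InnerProductSpace ℝ H]
  [CompleteSpace H] [RKHS ℝ H E ℝ]

/-- The feature map is `x ↦ RKHS.kerFun H x 1`. Seeing the kernel as its Gram kernel gives both the
sup-norm bound and the continuity of elements of `H`. -/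
lemma scalarKernel_eq_inner (x x' : E) :
    scalarKernel H x x' = inner ℝ (RKHS.kerFun H x (1 : ℝ)) (RKHS.kerFun H x' (1 : ℝ)) := by
  rw [scalarKernel, real_inner_comm, ← RKHS.kernel_inner]
  simp

lemma apply_eq_inner (f : H) (x : E) : f x = inner ℝ f (RKHS.kerFun H x (1 : ℝ)) := by
  simp

lemma kernelNorm_nonneg : 0 ≤ kernelNorm (E := E) H :=
  Real.iSup_nonneg fun _ => Real.sqrt_nonneg _

/-- The reproducing property bounds the sup-norm of an element by its Hilbert norm. -/
lemma abs_apply_le (hb : BddAbove (range fun x : E => √(scalarKernel H x x))) (f : H) (x : E) :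
    |f x| ≤ kernelNorm (E := E) H * ‖f‖ := by
  rw [apply_eq_inner, mul_comm]
  refine (abs_real_inner_le_norm _ _).trans ?_
  gcongr
  refine le_trans (le_of_eq ?_) (le_ciSup hb x)
  rw [scalarKernel_eq_inner, real_inner_self_eq_norm_sq, Real.sqrt_sq (norm_nonneg _)]

/-- The elements of a reproducing kernel Hilbert space with continuous kernel are continuous. -/
lemma continuous_of_continuous_kernel [TopologicalSpace E]
    (hk : Continuous fun p : E × E => scalarKernel H p.1 p.2) (f : H) : Continuous f := by
  simp_rw [scalarKernel_eq_inner] at hk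
  exact (continuous_const.inner (continuous_of_continuous_inner hk)).congr fun x =>
    (apply_eq_inner f x).symm

end Evaluation

/-! ### Regularity of the loss and of its first two derivatives. -/

section Loss

variable {Y : Type*} [MeasurableSpace Y]

/-- A measurable convex loss, Lipschitz with constant `ℓ` and twice continuously differentiable
in its last argument, with second derivative bounded by `M`. -/
structure SmoothLoss (L : Y → ℝ → ℝ) (ℓ M : ℝ≥0) : Prop where
  measurable : Measurable (Function.uncurry L)
  convex : ∀ y, ConvexOn ℝ univ (L y)
  lipschitz : ∀ y, LipschitzWith ℓ (L y)
  contDiff : ∀ y, ContDiff ℝ 2 (L y)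
  abs_deriv_two_le : ∀ y t, |deriv (deriv (L y)) t| ≤ M

-- The steps 1 / (n + 1) form a sequence, so a partial derivative becomes a countable limit of
-- measurable functions.
omit [MeasurableSpace Y] in
lemma tendsto_slope_nat {g : ℝ → ℝ} {g' t : ℝ} (h : HasDerivAt g g' t) :
    Tendsto (fun n : ℕ => ((n : ℝ) + 1) * (g (t + 1 / ((n : ℝ) + 1)) - g t)) atTop (𝓝 g') := by
  have h1 : Tendsto (fun n : ℕ => 1 / ((n : ℝ) + 1)) atTop (𝓝[≠] 0) :=
    tendsto_nhdsWithin_iff.2 ⟨tendsto_one_div_add_atTop_nhds_zero_nat,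
      Eventually.of_forall fun n => by
        simp only [mem_compl_iff, mem_singleton_iff]; positivity⟩
  have h2 := h.tendsto_slope_zero.comp h1
  refine h2.congr fun n => ?_
  simp

/-- A partial derivative of a jointly measurable function is jointly measurable. -/
lemma measurable_uncurry_deriv {g : Y → ℝ → ℝ} (hg : Measurable (Function.uncurry g))
    (hd : ∀ y, Differentiable ℝ (g y)) : Measurable (Function.uncurry fun y => deriv (g y)) := by
  refine measurable_of_tendsto_metrizable
    (f := fun (n : ℕ) (p : Y × ℝ) => ((n : ℝ) + 1) * (g p.1 (p.2 + 1 / ((n : ℝ) + 1)) - g p.1 p.2))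
    (fun n => ?_) ?_
  · have h1 : Measurable fun p : Y × ℝ => g p.1 (p.2 + 1 / ((n : ℝ) + 1)) :=
      hg.comp (measurable_fst.prodMk (measurable_snd.add_const _))
    exact (h1.sub hg).const_mul _
  · exact tendsto_pi_nhds.2 fun p => tendsto_slope_nat ((hd p.1) p.2).hasDerivAt

namespace SmoothLoss

variable {L : Y → ℝ → ℝ} {ℓ M : ℝ≥0} (hL : SmoothLoss L ℓ M)
include hL

lemma differentiable (y : Y) : Differentiable ℝ (L y) := (hL.contDiff y).differentiable (by norm_num)

lemma differentiable_deriv (y : Y) : Differentiable ℝ (deriv (L y)) :=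
  (hL.contDiff y).differentiable_deriv_two

lemma hasDerivAt (y : Y) (t : ℝ) : HasDerivAt (L y) (deriv (L y) t) t :=
  (hL.differentiable y t).hasDerivAt

lemma hasDerivAt_deriv (y : Y) (t : ℝ) : HasDerivAt (deriv (L y)) (deriv (deriv (L y)) t) t :=
  (hL.differentiable_deriv y t).hasDerivAt

lemma abs_deriv_le (y : Y) (t : ℝ) : |deriv (L y) t| ≤ ℓ :=
  norm_deriv_le_of_lipschitz (hL.lipschitz y)

lemma lipschitz_deriv (y : Y) : LipschitzWith M (deriv (L y)) :=
  lipschitzWith_of_nnnorm_deriv_le (hL.differentiable_deriv y) fun t => by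
    rw [← NNReal.coe_le_coe]; exact hL.abs_deriv_two_le y t

lemma abs_deriv_sub_le (y : Y) (s t : ℝ) : |deriv (L y) s - deriv (L y) t| ≤ M * |s - t| := by
  have := (hL.lipschitz_deriv y).dist_le_mul s t
  rwa [Real.dist_eq, Real.dist_eq] at this

lemma abs_sub_le (y : Y) (s t : ℝ) : |L y s - L y t| ≤ ℓ * |s - t| := by
  have := (hL.lipschitz y).dist_le_mul s t
  rwa [Real.dist_eq, Real.dist_eq] at this

/-- Beyond the existence of minimizers, convexity is used only through this and the resulting sign
of L'': the first gives stability, the second coercivity. -/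
lemma monotone_deriv (y : Y) : Monotone (deriv (L y)) := by
  have := (hL.convex y).monotoneOn_deriv fun t _ => hL.differentiable y t
  simpa [monotoneOn_univ] using this

lemma deriv_two_nonneg (y : Y) (t : ℝ) : 0 ≤ deriv (deriv (L y)) t :=
  (hL.monotone_deriv y).deriv_nonneg

lemma measurable_deriv : Measurable (Function.uncurry fun y => deriv (L y)) :=
  measurable_uncurry_deriv hL.measurable hL.differentiable

lemma measurable_deriv_two : Measurable (Function.uncurry fun y => deriv (deriv (L y))) :=
  measurable_uncurry_deriv hL.measurable_deriv hL.differentiable_deriv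

end SmoothLoss

end Loss

end LocalSVM

namespace LocalSVM

/-! ### Existence of support vector machines and their first-order condition. -/

section SupportVectorMachine

variable {E Y H : Type*} [MeasurableSpace E] [MeasurableSpace Y]
  [NormedAddCommGroup H] [InnerProductSpace ℝ H] [RKHS ℝ H E ℝ]
  {L : Y → ℝ → ℝ} {ℓ M κ : ℝ≥0} {lam : ℝ} {ν : Measure (E × Y)}

lemma measurable_uncurry_comp {g : Y → ℝ → ℝ} (hg : Measurable (Function.uncurry g)) {f : E → ℝ}
    (hf : Measurable f) : Measurable fun p : E × Y => g p.2 (f p.1) :=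
  hg.comp (measurable_snd.prodMk (hf.comp measurable_fst))

lemma abs_integral_le_of_forall {α : Type*} [MeasurableSpace α] {μ : Measure α}
    [IsProbabilityMeasure μ] {φ : α → ℝ} {C : ℝ} (h : ∀ p, |φ p| ≤ C) : |∫ p, φ p ∂μ| ≤ C := by
  simpa using norm_integral_le_of_norm_le_const (μ := μ) (f := φ) (C := C) (.of_forall h)

-- The reason for shifting the loss: the shifted loss is bounded along elements of `H`, so its risk
-- is finite without any moment condition on the law.
omit [MeasurableSpace E] in
lemma abs_shiftedLoss_le (hL : SmoothLoss L ℓ M) (hκ : ∀ (f : H) x, |f x| ≤ κ * ‖f‖) (f : H)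
    (x : E) (y : Y) : |shiftedLoss L y (f x)| ≤ ℓ * (κ * ‖f‖) := by
  have h := hL.abs_sub_le y (f x) 0
  rw [sub_zero] at h
  exact h.trans (mul_le_mul_of_nonneg_left (hκ f x) ℓ.2)

lemma measurable_shiftedLoss (hL : SmoothLoss L ℓ M) {f : E → ℝ} (hf : Measurable f) :
    Measurable fun p : E × Y => shiftedLoss L p.2 (f p.1) :=
  (measurable_uncurry_comp hL.measurable hf).sub
    (measurable_uncurry_comp hL.measurable measurable_const)

lemma integrable_shiftedLoss [IsFiniteMeasure ν] (hL : SmoothLoss L ℓ M)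
    (hκ : ∀ (f : H) x, |f x| ≤ κ * ‖f‖) (hm : ∀ f : H, Measurable f) (f : H) :
    Integrable (fun p => shiftedLoss L p.2 (f p.1)) ν :=
  .of_bound (measurable_shiftedLoss hL (hm f)).aestronglyMeasurable (ℓ * (κ * ‖f‖))
    (.of_forall fun p => abs_shiftedLoss_le hL hκ f p.1 p.2)

lemma convexOn_risk [IsFiniteMeasure ν] (hL : SmoothLoss L ℓ M)
    (hκ : ∀ (f : H) x, |f x| ≤ κ * ‖f‖) (hm : ∀ f : H, Measurable f) :
    ConvexOn ℝ univ fun f : H => ∫ p, shiftedLoss L p.2 (f p.1) ∂ν := by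
  refine ⟨convex_univ, fun f _ g _ a b ha hb hab => ?_⟩
  have hi := fun f => integrable_shiftedLoss (ν := ν) hL hκ hm f
  simp only [smul_eq_mul]
  rw [← integral_const_mul, ← integral_const_mul,
    ← integral_add ((hi f).const_mul a) ((hi g).const_mul b)]
  refine integral_mono (hi _) (((hi f).const_mul a).add ((hi g).const_mul b)) fun p => ?_
  have h := (hL.convex p.2).2 (mem_univ (f p.1)) (mem_univ (g p.1)) ha hb hab
  have h2 : L p.2 0 = a * L p.2 0 + b * L p.2 0 := by rw [← add_mul, hab, one_mul]
  simp only [smul_eq_mul] at h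
  simp only [shiftedLoss, RKHS.coe_add, RKHS.coe_smul, Pi.add_apply, Pi.smul_apply, smul_eq_mul]
  linarith

lemma lipschitzWith_risk [IsProbabilityMeasure ν] (hL : SmoothLoss L ℓ M)
    (hκ : ∀ (f : H) x, |f x| ≤ κ * ‖f‖) (hm : ∀ f : H, Measurable f) :
    LipschitzWith (ℓ * κ) fun f : H => ∫ p, shiftedLoss L p.2 (f p.1) ∂ν := by
  refine LipschitzWith.of_dist_le_mul fun f g => ?_
  have hi := fun f => integrable_shiftedLoss (ν := ν) hL hκ hm f
  rw [dist_eq_norm, dist_eq_norm, ← integral_sub (hi f) (hi g)]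
  refine (abs_integral_le_of_forall (C := ℓ * (κ * ‖f - g‖)) fun p => ?_).trans
    (le_of_eq (by simp [mul_assoc]))
  have h := hL.abs_sub_le p.2 (f p.1) (g p.1)
  have h2 := hκ (f - g) p.1
  rw [RKHS.coe_sub, Pi.sub_apply] at h2
  rw [shiftedLoss, shiftedLoss, sub_sub_sub_cancel_right]
  exact h.trans (mul_le_mul_of_nonneg_left h2 ℓ.2)

/-- Support vector machines exist and are unique. -/
theorem existsUnique_isSVM [CompleteSpace H] [IsProbabilityMeasure ν] (hL : SmoothLoss L ℓ M)
    (hκ : ∀ (f : H) x, |f x| ≤ κ * ‖f‖) (hm : ∀ f : H, Measurable f) (hlam : 0 < lam) :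
    ∃! f : H, IsSVM L lam ν f :=
  existsUnique_forall_add_sq_le (convexOn_risk hL hκ hm) (lipschitzWith_risk hL hκ hm) hlam

omit [MeasurableSpace E] in
lemma abs_deriv_mul_le (hL : SmoothLoss L ℓ M) (hκ : ∀ (f : H) x, |f x| ≤ κ * ‖f‖) (f h : H)
    (x : E) (y : Y) : |deriv (L y) (f x) * h x| ≤ ℓ * (κ * ‖h‖) := by
  rw [abs_mul]
  exact mul_le_mul (hL.abs_deriv_le _ _) (hκ h x) (abs_nonneg _) ℓ.2

lemma measurable_deriv_mul (hL : SmoothLoss L ℓ M) {f h : E → ℝ} (hf : Measurable f)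
    (hh : Measurable h) : Measurable fun p : E × Y => deriv (L p.2) (f p.1) * h p.1 :=
  (measurable_uncurry_comp hL.measurable_deriv hf).mul (hh.comp measurable_fst)

lemma integrable_deriv_mul [IsFiniteMeasure ν] (hL : SmoothLoss L ℓ M)
    (hκ : ∀ (f : H) x, |f x| ≤ κ * ‖f‖) (hm : ∀ f : H, Measurable f) (f h : H) :
    Integrable (fun p => deriv (L p.2) (f p.1) * h p.1) ν :=
  .of_bound (measurable_deriv_mul hL (hm f) (hm h)).aestronglyMeasurable (ℓ * (κ * ‖h‖))
    (.of_forall fun p => abs_deriv_mul_le hL hκ f h p.1 p.2)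

/-- The first-order condition for support vector machines. -/
theorem IsSVM.integral_deriv_mul_add_inner [IsFiniteMeasure ν] (hL : SmoothLoss L ℓ M)
    (hκ : ∀ (f : H) x, |f x| ≤ κ * ‖f‖) (hm : ∀ f : H, Measurable f) {f : H}
    (hf : IsSVM L lam ν f) (h : H) :
    (∫ p, deriv (L p.2) (f p.1) * h p.1 ∂ν) + 2 * lam * inner ℝ f h = 0 := by
  have h1 : HasDerivAt (fun t : ℝ => ∫ p, shiftedLoss L p.2 ((f + t • h) p.1) ∂ν)
      (∫ p, deriv (L p.2) ((f + (0 : ℝ) • h) p.1) * h p.1 ∂ν) 0 := by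
    refine (hasDerivAt_integral_of_dominated_loc_of_deriv_le (s := univ)
      (F' := fun t (p : E × Y) => deriv (L p.2) ((f + t • h) p.1) * h p.1)
      (bound := fun _ => ℓ * (κ * ‖h‖)) univ_mem ?_ (integrable_shiftedLoss hL hκ hm _)
      (integrable_deriv_mul hL hκ hm _ _).aestronglyMeasurable ?_ (integrable_const _) ?_).2
    · exact .of_forall fun t => (integrable_shiftedLoss hL hκ hm _).aestronglyMeasurable
    · exact .of_forall fun p t _ => abs_deriv_mul_le hL hκ _ _ _ _
    · refine .of_forall fun p t _ => ?_
      have h2 : HasDerivAt (fun t : ℝ => (f + t • h) p.1) (h p.1) t := by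
        simp only [RKHS.coe_add, RKHS.coe_smul, Pi.add_apply, Pi.smul_apply, smul_eq_mul]
        simpa using ((hasDerivAt_id t).mul_const (h p.1)).const_add (f p.1)
      exact ((hL.hasDerivAt p.2 _).comp t h2).sub_const (L p.2 0)
  have h3 : HasDerivAt (fun t : ℝ => lam * ‖f + t • h‖ ^ 2) (2 * lam * inner ℝ f h) 0 := by
    have h4 : HasDerivAt (fun t : ℝ => f + t • h) h 0 := by
      simpa using ((hasDerivAt_id (0 : ℝ)).smul_const h).const_add f
    have h5 := (h4.norm_sq).const_mul lam
    simp only [zero_smul, add_zero] at h5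
    exact h5.congr_deriv (by ring)
  have h6 := h1.add h3
  simp only [zero_smul, add_zero] at h6
  refine IsLocalMin.hasDerivAt_eq_zero (.of_forall fun t => ?_) h6
  simpa [regRisk] using hf (f + t • h)

/-! ### Contamination by a point mass and stability of the minimizer. -/

/-- The mixture `(1 - ε) ν + ε δ_z`. -/
noncomputable def mixture {α : Type*} [MeasurableSpace α] (ν : Measure α) (z : α) (ε : ℝ) :
    Measure α :=
  ENNReal.ofReal (1 - ε) • ν + ENNReal.ofReal ε • Measure.dirac z

section Mixture

variable {α : Type*} [MeasurableSpace α] {μ : Measure α} {z : α} {ε : ℝ}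

lemma isProbabilityMeasure_mixture [IsProbabilityMeasure μ] (hε : ε ∈ Icc (0 : ℝ) 1) :
    IsProbabilityMeasure (mixture μ z ε) := by
  constructor
  simp only [mixture, Measure.coe_add, Measure.coe_smul, Pi.add_apply, Pi.smul_apply,
    measure_univ, smul_eq_mul, mul_one]
  rw [← ENNReal.ofReal_add (by linarith [hε.2]) hε.1]
  simp

lemma integral_mixture (hε : ε ∈ Icc (0 : ℝ) 1) {φ : α → ℝ} (hφ : Integrable φ μ)
    (hm : Measurable φ) : ∫ p, φ p ∂(mixture μ z ε) = (1 - ε) * ∫ p, φ p ∂μ + ε * φ z := by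
  -- Singletons need not be measurable here, so Dirac integrals rely on the measurability of `φ`.
  have hd : Integrable φ (Measure.dirac z) :=
    ⟨hm.aestronglyMeasurable, by
      rw [HasFiniteIntegral, lintegral_dirac' _ hm.enorm]; exact enorm_lt_top⟩
  rw [mixture, integral_add_measure (hφ.smul_measure ENNReal.ofReal_ne_top)
    (hd.smul_measure ENNReal.ofReal_ne_top), integral_smul_measure, integral_smul_measure,
    integral_dirac' _ _ hm.stronglyMeasurable, ENNReal.toReal_ofReal (by linarith [hε.2]),
    ENNReal.toReal_ofReal hε.1, smul_eq_mul, smul_eq_mul]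

end Mixture

/-- Makes the explicit dependence on ε visible, so that the conditions for different ε can be
subtracted. -/
lemma IsSVM.mixture_eq [IsProbabilityMeasure ν] (hL : SmoothLoss L ℓ M)
    (hκ : ∀ (f : H) x, |f x| ≤ κ * ‖f‖) (hm : ∀ f : H, Measurable f) {z : E × Y} {ε : ℝ}
    (hε : ε ∈ Icc (0 : ℝ) 1) {f : H} (hf : IsSVM L lam (mixture ν z ε) f) (h : H) :
    (1 - ε) * (∫ p, deriv (L p.2) (f p.1) * h p.1 ∂ν) + ε * (deriv (L z.2) (f z.1) * h z.1)
      + 2 * lam * inner ℝ f h = 0 := by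
  have := isProbabilityMeasure_mixture (μ := ν) (z := z) hε
  rw [← integral_mixture hε (integrable_deriv_mul hL hκ hm f h)
    (measurable_deriv_mul hL (hm f) (hm h))]
  exact hf.integral_deriv_mul_add_inner hL hκ hm h

/-- Contaminating the law with weight `ε` moves the support vector machine by at most a multiple
of `ε`. -/
theorem IsSVM.norm_mixture_sub_le [IsProbabilityMeasure ν] (hL : SmoothLoss L ℓ M)
    (hκ : ∀ (f : H) x, |f x| ≤ κ * ‖f‖) (hm : ∀ f : H, Measurable f) (hlam : 0 < lam)
    {z : E × Y} {ε : ℝ} (hε : ε ∈ Icc (0 : ℝ) 1) {f f₀ : H}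
    (hf : IsSVM L lam (mixture ν z ε) f) (hf₀ : IsSVM L lam ν f₀) :
    ‖f - f₀‖ ≤ ε * (ℓ * κ / lam) := by
  have h1 := hf.mixture_eq hL hκ hm hε (f - f₀)
  have h2 := hf₀.integral_deriv_mul_add_inner hL hκ hm (f - f₀)
  have h3 : inner ℝ f (f - f₀) = inner ℝ f₀ (f - f₀) + ‖f - f₀‖ ^ 2 := by
    rw [← real_inner_self_eq_norm_sq, ← inner_add_left, add_sub_cancel]
  -- Pointwise (L'(f) - L'(f₀)) (f - f₀) ≥ 0, as L' is monotone.
  have h4 : ∫ p, deriv (L p.2) (f₀ p.1) * (f - f₀) p.1 ∂ν ≤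
      ∫ p, deriv (L p.2) (f p.1) * (f - f₀) p.1 ∂ν := by
    refine integral_mono (integrable_deriv_mul hL hκ hm _ _) (integrable_deriv_mul hL hκ hm _ _)
      fun p => ?_
    simp only [RKHS.coe_sub, Pi.sub_apply]
    rcases le_total (f p.1) (f₀ p.1) with h | h
    · exact mul_le_mul_of_nonpos_right (hL.monotone_deriv _ h) (sub_nonpos.2 h)
    · exact mul_le_mul_of_nonneg_right (hL.monotone_deriv _ h) (sub_nonneg.2 h)
  have h5 : |∫ p, deriv (L p.2) (f₀ p.1) * (f - f₀) p.1 ∂ν| ≤ ℓ * (κ * ‖f - f₀‖) :=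
    abs_integral_le_of_forall fun p => abs_deriv_mul_le hL hκ _ _ _ _
  have h6 := abs_deriv_mul_le hL hκ f (f - f₀) z.1 z.2
  set A := ∫ p, deriv (L p.2) (f p.1) * (f - f₀) p.1 ∂ν
  set A₀ := ∫ p, deriv (L p.2) (f₀ p.1) * (f - f₀) p.1 ∂ν
  set D := deriv (L z.2) (f z.1) * (f - f₀) z.1
  set n := ‖f - f₀‖
  rw [h3] at h1
  have h7 : (1 - ε) * A₀ ≤ (1 - ε) * A := mul_le_mul_of_nonneg_left h4 (by linarith [hε.2])
  have h8 : ε * (A₀ - D) ≤ ε * (2 * (ℓ * (κ * n))) :=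
    mul_le_mul_of_nonneg_left (by linarith [(abs_le.1 h5).2, (abs_le.1 h6).1]) hε.1
  -- The difference of `h1` and `h2`, with `A` replaced by `A₀` through `h7`, leaves 2 lam n² ≤ ε
  -- (A₀ - D).
  have h9 : 2 * lam * n ^ 2 ≤ ε * (2 * (ℓ * (κ * n))) := by linarith
  rcases (norm_nonneg (f - f₀)).eq_or_lt with h0 | h0
  · have : n = 0 := h0.symm
    rw [this]
    have := hε.1
    positivity
  · have h10 : lam * n ≤ ε * (ℓ * κ) := by
      have h11 : (lam * n) * n ≤ (ε * (ℓ * κ)) * n := by linarith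
      exact le_of_mul_le_mul_right h11 h0
    rw [← mul_div_assoc, le_div_iff₀ hlam]
    linarith

/-! ### Linearization of the first-order condition and the influence function in the Hilbert space.
-/

omit [MeasurableSpace E] in
lemma abs_deriv_two_mul_mul_le (hL : SmoothLoss L ℓ M) (hκ : ∀ (f : H) x, |f x| ≤ κ * ‖f‖)
    (f u h : H) (x : E) (y : Y) :
    |deriv (deriv (L y)) (f x) * u x * h x| ≤ M * (κ * ‖u‖) * (κ * ‖h‖) := by
  rw [abs_mul, abs_mul]
  have h1 := hL.abs_deriv_two_le y (f x)
  have h2 := hκ u x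
  have h3 := hκ h x
  gcongr

lemma integrable_deriv_two_mul_mul [IsFiniteMeasure ν] (hL : SmoothLoss L ℓ M)
    (hκ : ∀ (f : H) x, |f x| ≤ κ * ‖f‖) (hm : ∀ f : H, Measurable f) (f u h : H) :
    Integrable (fun p => deriv (deriv (L p.2)) (f p.1) * u p.1 * h p.1) ν :=
  .of_bound (((measurable_uncurry_comp hL.measurable_deriv_two (hm f)).mul
      ((hm u).comp measurable_fst)).mul ((hm h).comp measurable_fst)).aestronglyMeasurable
    (M * (κ * ‖u‖) * (κ * ‖h‖))
    (.of_forall fun p => abs_deriv_two_mul_mul_le hL hκ f u h p.1 p.2)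

/-- The linearization of the first-order condition is solvable. -/
theorem exists_linearized_solution [CompleteSpace H] [IsProbabilityMeasure ν]
    (hL : SmoothLoss L ℓ M) (hκ : ∀ (f : H) x, |f x| ≤ κ * ‖f‖) (hm : ∀ f : H, Measurable f)
    (hlam : 0 < lam) (f v : H) :
    ∃ g : H, ∀ h : H, 2 * lam * inner ℝ g h +
      (∫ p, deriv (deriv (L p.2)) (f p.1) * g p.1 * h p.1 ∂ν) = inner ℝ v h := by
  have hi := fun u h => integrable_deriv_two_mul_mul (ν := ν) hL hκ hm f u h
  -- The formal second derivative of the unregularized risk at `f`.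
  let Q : H →ₗ[ℝ] H →ₗ[ℝ] ℝ :=
    LinearMap.mk₂ ℝ (fun u h : H => ∫ p, deriv (deriv (L p.2)) (f p.1) * u p.1 * h p.1 ∂ν)
      (fun u u' h => by
        rw [← integral_add (hi _ _) (hi _ _)]
        congr 1 with p
        simp only [RKHS.coe_add, Pi.add_apply]; ring)
      (fun c u h => by
        rw [smul_eq_mul, ← integral_const_mul]
        congr 1 with p
        simp only [RKHS.coe_smul, Pi.smul_apply, smul_eq_mul]; ring)
      (fun u h h' => by
        rw [← integral_add (hi _ _) (hi _ _)]
        congr 1 with p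
        simp only [RKHS.coe_add, Pi.add_apply]; ring)
      (fun c u h => by
        rw [smul_eq_mul, ← integral_const_mul]
        congr 1 with p
        simp only [RKHS.coe_smul, Pi.smul_apply, smul_eq_mul]; ring)
  have hQ : ∀ u h, |Q u h| ≤ M * κ * κ * ‖u‖ * ‖h‖ := fun u h =>
    (abs_integral_le_of_forall (C := M * (κ * ‖u‖) * (κ * ‖h‖))
      fun p : E × Y => abs_deriv_two_mul_mul_le hL hκ f u h p.1 p.2).trans (le_of_eq (by ring))
  let T : H →L[ℝ] H →L[ℝ] ℝ := ((2 * lam) • innerₗ H + Q).mkContinuous₂ (2 * lam + M * κ * κ)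
    fun u h => by
      refine (abs_add_le _ _).trans ?_
      rw [add_mul, add_mul]
      refine add_le_add ?_ (hQ u h)
      change |2 * lam * inner ℝ u h| ≤ _
      rw [abs_mul, abs_of_pos (by positivity), mul_assoc (2 * lam) ‖u‖]
      exact mul_le_mul_of_nonneg_left (abs_real_inner_le_norm u h) (by positivity)
  have hT : ∀ u h, T u h = 2 * lam * inner ℝ u h +
      ∫ p, deriv (deriv (L p.2)) (f p.1) * u p.1 * h p.1 ∂ν := fun u h => rfl
  -- Coercivity comes from the regularizer alone; the risk part is nonnegative because L'' ≥ 0.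
  -- Lax-Milgram then inverts `T`.
  have hc : IsCoercive T := by
    refine ⟨2 * lam, by positivity, fun u => ?_⟩
    rw [hT, real_inner_self_eq_norm_mul_norm, ← mul_assoc]
    refine le_add_of_nonneg_right (integral_nonneg fun p => ?_)
    simp only [Pi.zero_apply, mul_assoc]
    exact mul_nonneg (hL.deriv_two_nonneg _ _) (mul_self_nonneg _)
  refine ⟨hc.continuousLinearEquivOfBilin.symm v, fun h => ?_⟩
  rw [← hT, ← hc.continuousLinearEquivOfBilin_apply, ContinuousLinearEquiv.apply_symm_apply]

/-- The remainder in the linearization of `L'` along a curve of Lipschitz type vanishes in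
mean. -/
theorem tendsto_integral_linearization [IsProbabilityMeasure ν] (hL : SmoothLoss L ℓ M)
    {f : ℝ → E → ℝ} {f₀ : E → ℝ} (hm : ∀ ε, Measurable (f ε)) (hm₀ : Measurable f₀) {C : ℝ}
    (hC : ∀ ε ∈ Ioc (0 : ℝ) 1, ∀ x, |f ε x - f₀ x| ≤ C * ε) :
    Tendsto (fun ε : ℝ => ∫ p, |(deriv (L p.2) (f ε p.1) - deriv (L p.2) (f₀ p.1)) / ε -
      deriv (deriv (L p.2)) (f₀ p.1) * ((f ε p.1 - f₀ p.1) / ε)| ∂ν) (𝓝[>] 0) (𝓝 0) := by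
  have hev : ∀ᶠ ε : ℝ in 𝓝[>] 0, ε ∈ Ioc (0 : ℝ) 1 := Ioc_mem_nhdsGT one_pos
  suffices h : Tendsto _ (𝓝[>] (0 : ℝ)) (𝓝 (∫ _ : E × Y, (0 : ℝ) ∂ν)) by
    rwa [integral_zero] at h
  -- L' is M-Lipschitz, |L''| ≤ M and the quotients of `f` are at most C, so each of the two terms
  -- is at most M C.
  refine tendsto_integral_filter_of_dominated_convergence (fun _ => M * C + M * C)
    (.of_forall fun ε => ?_) ?_ (integrable_const _) (.of_forall fun p => ?_)
  · have h1 := measurable_uncurry_comp hL.measurable_deriv (hm ε)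
    have h2 := measurable_uncurry_comp hL.measurable_deriv hm₀
    have h3 := measurable_uncurry_comp hL.measurable_deriv_two hm₀
    have h4 : Measurable fun p : E × Y => (f ε p.1 - f₀ p.1) / ε :=
      (((hm ε).sub hm₀).comp measurable_fst).div_const ε
    exact (((h1.sub h2).div_const ε).sub (h3.mul h4)).abs.aestronglyMeasurable
  · filter_upwards [hev] with ε hε
    refine .of_forall fun p => ?_
    have h1 := hC ε hε p.1
    have h2 : |(f ε p.1 - f₀ p.1) / ε| ≤ C := by
      rw [abs_div, abs_of_pos hε.1, div_le_iff₀ hε.1]; exact h1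
    have h3 : |(deriv (L p.2) (f ε p.1) - deriv (L p.2) (f₀ p.1)) / ε| ≤ M * C := by
      rw [abs_div, abs_of_pos hε.1, div_le_iff₀ hε.1, mul_assoc]
      exact (hL.abs_deriv_sub_le _ _ _).trans (mul_le_mul_of_nonneg_left h1 M.2)
    rw [Real.norm_eq_abs, abs_abs]
    refine (abs_sub _ _).trans (add_le_add h3 ?_)
    rw [abs_mul]
    exact mul_le_mul (hL.abs_deriv_two_le _ _) h2 (abs_nonneg _) M.2
  -- The increment is O(ε), so the first-order Taylor remainder of L', which is o of the increment,
  -- is o(ε).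
  · have hO : (fun ε => f ε p.1 - f₀ p.1) =O[𝓝[>] 0] fun ε : ℝ => ε := by
      refine Asymptotics.IsBigO.of_bound C ?_
      filter_upwards [hev] with ε hε
      rw [Real.norm_eq_abs, Real.norm_eq_abs, abs_of_pos hε.1]
      exact hC ε hε p.1
    have hid : Tendsto (fun ε : ℝ => ε) (𝓝[>] 0) (𝓝 0) := tendsto_id.mono_left nhdsWithin_le_nhds
    have ht : Tendsto (fun ε => f ε p.1) (𝓝[>] 0) (𝓝 (f₀ p.1)) := by
      simpa using (hO.trans_tendsto hid).add_const (f₀ p.1)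
    have ho := ((hL.hasDerivAt_deriv p.2 (f₀ p.1)).isLittleO.comp_tendsto ht).trans_isBigO hO
    have h0 := ho.tendsto_div_nhds_zero.abs
    rw [abs_zero] at h0
    refine h0.congr fun ε => ?_
    simp only [Function.comp_apply, smul_eq_mul]
    congr 1
    ring

/-- The linearized solution approximates the difference quotients of support vector machines. -/
theorem norm_quotient_sub_le [CompleteSpace H] [IsProbabilityMeasure ν] (hL : SmoothLoss L ℓ M)
    (hκ : ∀ (f : H) x, |f x| ≤ κ * ‖f‖) (hm : ∀ f : H, Measurable f)
    {z : E × Y} {ε : ℝ} (hε : ε ∈ Ioc (0 : ℝ) 1) {f f₀ g : H}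
    (hf : IsSVM L lam (mixture ν z ε) f) (hf₀ : IsSVM L lam ν f₀)
    (hg : ∀ h : H, 2 * lam * inner ℝ g h +
      (∫ p, deriv (deriv (L p.2)) (f₀ p.1) * g p.1 * h p.1 ∂ν) =
        inner ℝ (-((2 * lam) • f₀) - deriv (L z.2) (f₀ z.1) • RKHS.kerFun H z.1 (1 : ℝ)) h) :
    2 * lam * ‖ε⁻¹ • (f - f₀) - g‖ ≤
      κ * (∫ p, |(deriv (L p.2) (f p.1) - deriv (L p.2) (f₀ p.1)) / ε -
        deriv (deriv (L p.2)) (f₀ p.1) * ((f p.1 - f₀ p.1) / ε)| ∂ν) +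
      2 * κ * (M * (κ * ‖f - f₀‖)) := by
  set r := ε⁻¹ • (f - f₀) - g with hr
  have hε0 : ε ≠ 0 := hε.1.ne'
  have hfr : f = f₀ + ε • (g + r) := by
    rw [hr, add_sub_cancel, smul_inv_smul₀ hε0, add_sub_cancel]
  have hi := fun f => integrable_deriv_mul (ν := ν) hL hκ hm f r
  have hi2 := fun u => integrable_deriv_two_mul_mul (ν := ν) hL hκ hm f₀ u r
  have hdiff : ∀ x y, |deriv (L y) (f x) * r x - deriv (L y) (f₀ x) * r x| ≤
      M * (κ * ‖f - f₀‖) * (κ * ‖r‖) := fun x y => by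
    rw [← sub_mul, abs_mul]
    have h1 := hκ (f - f₀) x
    rw [RKHS.coe_sub, Pi.sub_apply] at h1
    exact mul_le_mul ((hL.abs_deriv_sub_le y _ _).trans (mul_le_mul_of_nonneg_left h1 M.2))
      (hκ r x) (abs_nonneg _) (by positivity)
  have e1 := hf.mixture_eq hL hκ hm ⟨hε.1.le, hε.2⟩ r
  have e0 := hf₀.integral_deriv_mul_add_inner hL hκ hm r
  have eg := hg r
  have hinner : inner ℝ f r = inner ℝ f₀ r + ε * (inner ℝ g r + ‖r‖ ^ 2) := by
    conv_lhs => rw [hfr]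
    rw [inner_add_left, real_inner_smul_left, inner_add_left, real_inner_self_eq_norm_sq]
  have hv : inner ℝ (-((2 * lam) • f₀) - deriv (L z.2) (f₀ z.1) • RKHS.kerFun H z.1 (1 : ℝ)) r =
      -(2 * lam * inner ℝ f₀ r) - deriv (L z.2) (f₀ z.1) * r z.1 := by
    rw [inner_sub_left, inner_neg_left, real_inner_smul_left, real_inner_smul_left,
      RKHS.kerFun_inner]
    simp
  rw [hinner] at e1
  rw [hv] at eg
  have hD := hdiff z.1 z.2
  have hA : |(∫ p, deriv (L p.2) (f p.1) * r p.1 ∂ν) - ∫ p, deriv (L p.2) (f₀ p.1) * r p.1 ∂ν| ≤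
      M * (κ * ‖f - f₀‖) * (κ * ‖r‖) := by
    rw [← integral_sub (hi f) (hi f₀)]
    exact abs_integral_le_of_forall fun p => hdiff p.1 p.2
  have hQ : 0 ≤ ∫ p, deriv (deriv (L p.2)) (f₀ p.1) * r p.1 * r p.1 ∂ν :=
    integral_nonneg fun p => by
      simp only [Pi.zero_apply, mul_assoc]
      exact mul_nonneg (hL.deriv_two_nonneg _ _) (mul_self_nonneg _)
  set R : E × Y → ℝ := fun p => (deriv (L p.2) (f p.1) - deriv (L p.2) (f₀ p.1)) / ε -
    deriv (deriv (L p.2)) (f₀ p.1) * ((f p.1 - f₀ p.1) / ε) with hR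
  -- Since (f - f₀) / ε = g + r, the L'' term splits into a part matching the equation for `g` and a
  -- nonnegative quadratic in `r`.
  have hRr : ∀ p, R p * r p.1 = ε⁻¹ * (deriv (L p.2) (f p.1) * r p.1 -
      deriv (L p.2) (f₀ p.1) * r p.1) - (deriv (deriv (L p.2)) (f₀ p.1) * g p.1 * r p.1 +
        deriv (deriv (L p.2)) (f₀ p.1) * r p.1 * r p.1) := fun p => by
    have h1 : f p.1 = f₀ p.1 + ε * (g p.1 + r p.1) := by
      conv_lhs => rw [hfr]
      simp [mul_add]
    have h2 : (f p.1 - f₀ p.1) / ε = g p.1 + r p.1 := by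
      rw [h1, add_sub_cancel_left, mul_div_cancel_left₀ _ hε0]
    simp only [hR]
    rw [h2]
    ring
  have hN : ∫ p, R p * r p.1 ∂ν = ε⁻¹ * ((∫ p, deriv (L p.2) (f p.1) * r p.1 ∂ν) -
      ∫ p, deriv (L p.2) (f₀ p.1) * r p.1 ∂ν) -
        ((∫ p, deriv (deriv (L p.2)) (f₀ p.1) * g p.1 * r p.1 ∂ν) +
          ∫ p, deriv (deriv (L p.2)) (f₀ p.1) * r p.1 * r p.1 ∂ν) := by
    have h1 : Integrable (fun p => ε⁻¹ * (deriv (L p.2) (f p.1) * r p.1 -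
      deriv (L p.2) (f₀ p.1) * r p.1)) ν := ((hi f).sub (hi f₀)).const_mul _
    have h2 : Integrable (fun p => deriv (deriv (L p.2)) (f₀ p.1) * g p.1 * r p.1 +
        deriv (deriv (L p.2)) (f₀ p.1) * r p.1 * r p.1) ν := (hi2 g).add (hi2 r)
    simp_rw [hRr]
    rw [integral_sub h1 h2,
      integral_add (hi2 g) (hi2 r), integral_const_mul, integral_sub (hi f) (hi f₀)]
  have hRi : Integrable R ν := by
    have h3 := measurable_uncurry_comp (E := E) hL.measurable_deriv_two (hm f₀)
    have h4 : Measurable fun p : E × Y => (f p.1 - f₀ p.1) / ε :=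
      (((hm f).sub (hm f₀)).comp measurable_fst).div_const ε
    have h5 : ∀ (f : H), Integrable (fun p : E × Y => deriv (L p.2) (f p.1)) ν := fun f =>
      .of_bound (measurable_uncurry_comp hL.measurable_deriv (hm f)).aestronglyMeasurable ℓ
        (.of_forall fun p => hL.abs_deriv_le _ _)
    refine (((h5 f).sub (h5 f₀)).div_const ε).sub
      (.of_bound (h3.mul h4).aestronglyMeasurable (M * (κ * ‖f - f₀‖ / ε))
        (.of_forall fun p => ?_))
    rw [Real.norm_eq_abs, abs_mul, abs_div, abs_of_pos hε.1]
    have h6 := hκ (f - f₀) p.1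
    rw [RKHS.coe_sub, Pi.sub_apply] at h6
    have := hε.1
    exact mul_le_mul (hL.abs_deriv_two_le _ _) (by gcongr) (by positivity) M.2
  have hNle : |∫ p, R p * r p.1 ∂ν| ≤ (∫ p, |R p| ∂ν) * (κ * ‖r‖) := by
    rw [← integral_mul_const]
    refine norm_integral_le_of_norm_le (f := fun p => R p * r p.1) (hRi.abs.mul_const _)
      (.of_forall fun p => ?_)
    rw [Real.norm_eq_abs, abs_mul]
    exact mul_le_mul_of_nonneg_left (hκ r p.1) (abs_nonneg _)
  set A := ∫ p, deriv (L p.2) (f p.1) * r p.1 ∂ν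
  set A₀ := ∫ p, deriv (L p.2) (f₀ p.1) * r p.1 ∂ν
  set N := ∫ p, R p * r p.1 ∂ν
  set ρ := ∫ p, |R p| ∂ν
  -- The difference of `e1` and `e0`, divided by ε.
  have hkey : ε⁻¹ * (A - A₀) + deriv (L z.2) (f z.1) * r z.1 - A +
      2 * lam * (inner ℝ g r + ‖r‖ ^ 2) = 0 := by
    have h1 : ε * (ε⁻¹ * (A - A₀)) = A - A₀ := mul_inv_cancel_left₀ hε0 _
    refine (mul_eq_zero.1 (?_ : ε * _ = 0)).resolve_left hε0
    linarith
  -- Eliminating `g` by `eg`, the left side is -N, minus the quadratic term of `hQ`, plus A - A₀,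
  -- minus the change at `z` bounded by `hD`. The last two have the same bound, whence the factor 2.
  have h1 : 2 * lam * ‖r‖ ^ 2 ≤ (κ * ρ + 2 * κ * (M * (κ * ‖f - f₀‖))) * ‖r‖ := by
    linarith [(abs_le.1 hD).1, (abs_le.1 hA).2, (abs_le.1 hNle).1]
  rcases (norm_nonneg r).eq_or_lt with h0 | h0
  · rw [← h0, mul_zero]
    have : 0 ≤ ρ := integral_nonneg fun p => abs_nonneg _
    positivity
  · refine le_of_mul_le_mul_right ?_ h0
    linarith

/-- Support vector machines have an influence function in the Hilbert space, bounded by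
`ℓ κ / lam`. -/
theorem exists_tendsto_mixture [CompleteSpace H] [IsProbabilityMeasure ν] (hL : SmoothLoss L ℓ M)
    (hκ : ∀ (f : H) x, |f x| ≤ κ * ‖f‖) (hm : ∀ f : H, Measurable f) (hlam : 0 < lam)
    {z : E × Y} {f : ℝ → H} {f₀ : H} (hf : ∀ ε ∈ Ioc (0 : ℝ) 1, IsSVM L lam (mixture ν z ε) (f ε))
    (hf₀ : IsSVM L lam ν f₀) :
    ∃ g : H, ‖g‖ ≤ ℓ * κ / lam ∧
      Tendsto (fun ε : ℝ => ε⁻¹ • (f ε - f₀)) (𝓝[>] 0) (𝓝 g) := by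
  have hev : ∀ᶠ ε : ℝ in 𝓝[>] 0, ε ∈ Ioc (0 : ℝ) 1 := Ioc_mem_nhdsGT one_pos
  have hid : Tendsto (fun ε : ℝ => ε) (𝓝[>] 0) (𝓝 0) := tendsto_id.mono_left nhdsWithin_le_nhds
  have hd : ∀ ε ∈ Ioc (0 : ℝ) 1, ‖f ε - f₀‖ ≤ ε * (ℓ * κ / lam) := fun ε hε =>
    (hf ε hε).norm_mixture_sub_le hL hκ hm hlam ⟨hε.1.le, hε.2⟩ hf₀
  -- The right side is ∫ L'(y, f₀) h dν - L'(z.2, f₀(z.1)) h(z.1), from differentiating the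
  -- contaminated condition at ε = 0; the integral equals -2 lam ⟨f₀, h⟩ by optimality of `f₀`.
  obtain ⟨g, hg⟩ := exists_linearized_solution (ν := ν) hL hκ hm hlam f₀
    (-((2 * lam) • f₀) - deriv (L z.2) (f₀ z.1) • RKHS.kerFun H z.1 (1 : ℝ))
  have hlim : Tendsto (fun ε : ℝ => ε⁻¹ • (f ε - f₀)) (𝓝[>] 0) (𝓝 g) := by
    set ρ : ℝ → ℝ := fun ε => ∫ p, |(deriv (L p.2) (f ε p.1) - deriv (L p.2) (f₀ p.1)) / ε -
      deriv (deriv (L p.2)) (f₀ p.1) * ((f ε p.1 - f₀ p.1) / ε)| ∂ν with hρ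
    have hρ0 : Tendsto ρ (𝓝[>] 0) (𝓝 0) :=
      tendsto_integral_linearization (C := κ * (ℓ * κ / lam)) (f := fun ε => f ε) hL
        (fun ε => hm _) (hm _) fun ε hε x => by
          have h1 := hκ (f ε - f₀) x
          rw [RKHS.coe_sub, Pi.sub_apply] at h1
          refine h1.trans ?_
          rw [mul_assoc, mul_comm _ ε]
          exact mul_le_mul_of_nonneg_left (hd ε hε) κ.2
    have hb0 : Tendsto (fun ε => (κ * ρ ε + 2 * κ * (M * (κ * (ε * (ℓ * κ / lam))))) / (2 * lam))
        (𝓝[>] 0) (𝓝 0) := by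
      have h1 := ((hρ0.const_mul (κ : ℝ)).add
        (((((hid.mul_const (ℓ * κ / lam)).const_mul (κ : ℝ)).const_mul (M : ℝ)).const_mul
          (2 * κ : ℝ)))).div_const (2 * lam)
      simpa using h1
    refine tendsto_iff_norm_sub_tendsto_zero.2
      (squeeze_zero' (.of_forall fun _ => norm_nonneg _) ?_ hb0)
    filter_upwards [hev] with ε hε
    rw [le_div_iff₀ (by positivity), mul_comm]
    refine (norm_quotient_sub_le hL hκ hm hε (hf ε hε) hf₀ hg).trans ?_
    have := hd ε hε
    gcongr
  refine ⟨g, le_of_tendsto hlim.norm ?_, hlim⟩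
  filter_upwards [hev] with ε hε
  rw [norm_smul, Real.norm_eq_abs, abs_inv, abs_of_pos hε.1, inv_mul_le_iff₀ hε.1]
  exact hd ε hε

end SupportVectorMachine

end LocalSVM

namespace LocalSVM

/-! ### Regional laws and the limit on a single region. -/

section Region

variable {X Y : Type*} [MeasurableSpace X] [MeasurableSpace Y] {P : Measure (X × Y)} {R : Set X}

lemma fst_apply_eq_prod_univ (hR : MeasurableSet R) : P.fst R = P (R ×ˢ univ) := by
  rw [Measure.fst_apply hR, prod_univ]

lemma isProbabilityMeasure_regionalLaw [IsFiniteMeasure P] (hR : MeasurableSet R)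
    (h : P.fst R ≠ 0) : IsProbabilityMeasure (regionalLaw P R) := by
  rw [fst_apply_eq_prod_univ hR] at h
  have he : MeasurableEmbedding (Prod.map (Subtype.val : R → X) (id : Y → Y)) :=
    (MeasurableEmbedding.subtype_coe hR).prodMap .id
  have hi : Prod.map (Subtype.val : R → X) (id : Y → Y) '' univ = R ×ˢ univ := by
    rw [image_univ, range_prodMap, Subtype.range_coe, range_id]
  constructor
  rw [regionalLaw, if_pos (pos_iff_ne_zero.2 h), Measure.smul_apply, he.comap_apply, hi,
    smul_eq_mul, ENNReal.inv_mul_cancel h (measure_ne_top _ _)]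

lemma contaminatedLaw_of_mem {z : X × Y} (hz : z.1 ∈ R) (ε : ℝ) :
    contaminatedLaw P R z ε = mixture (regionalLaw P R) (⟨z.1, hz⟩, z.2) ε :=
  dif_pos hz

lemma contaminatedLaw_of_notMem {z : X × Y} (hz : z.1 ∉ R) (ε : ℝ) :
    contaminatedLaw P R z ε = regionalLaw P R :=
  dif_neg hz

lemma isProbabilityMeasure_contaminatedLaw [IsFiniteMeasure P] (hR : MeasurableSet R)
    (h : P.fst R ≠ 0) (z : X × Y) {ε : ℝ} (hε : ε ∈ Icc (0 : ℝ) 1) :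
    IsProbabilityMeasure (contaminatedLaw P R z ε) := by
  have := isProbabilityMeasure_regionalLaw hR h
  by_cases hz : z.1 ∈ R
  · rw [contaminatedLaw_of_mem hz]
    exact isProbabilityMeasure_mixture hε
  · rwa [contaminatedLaw_of_notMem hz]

lemma measurable_mul_extend {w : X → ℝ} (hw : Measurable w) (hR : MeasurableSet R) {f : R → ℝ}
    (hf : Measurable f) :
    Measurable fun x => w x * Function.extend (Subtype.val : R → X) f 0 x :=
  hw.mul ((MeasurableEmbedding.subtype_coe hR).measurable_extend hf measurable_const)

omit [MeasurableSpace X] in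
lemma extend_val_of_mem {f : R → ℝ} {x : X} (hx : x ∈ R) :
    Function.extend (Subtype.val : R → X) f 0 x = f ⟨x, hx⟩ :=
  Subtype.val_injective.extend_apply f 0 ⟨x, hx⟩

/-- Almost every point avoids all null regions, so the arbitrary predictors chosen there do not
affect L^∞ norms. -/
lemma ae_forall_mem_imp_ne_zero {ι : Type*} [Countable ι] (μ : Measure X) (R : ι → Set X) :
    ∀ᵐ x ∂μ, ∀ b, x ∈ R b → μ (R b) ≠ 0 := by
  refine ae_all_iff.2 fun b => ?_
  by_cases h : μ (R b) = 0
  · filter_upwards [measure_eq_zero_iff_ae_notMem.1 h] with x hx hx'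
    exact absurd hx' hx
  · exact .of_forall fun _ _ => h

lemma memLp_mul_extend {w : X → ℝ} (hw : Measurable w) (hw_mem : ∀ x, w x ∈ Icc (0 : ℝ) 1)
    (hw_zero : ∀ x ∉ R, w x = 0) (hR : MeasurableSet R) {μ : Measure X} {f : R → ℝ}
    (hf : Measurable f) (hb : μ R ≠ 0 → ∃ C, ∀ x, |f x| ≤ C) :
    MemLp (fun x => w x * Function.extend (Subtype.val : R → X) f 0 x) ∞ μ := by
  obtain ⟨C, hC⟩ : ∃ C, μ R ≠ 0 → ∀ x, |f x| ≤ C := by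
    by_cases h : μ R = 0
    · exact ⟨0, fun h' => absurd h h'⟩
    · exact (hb h).imp fun _ hC _ => hC
  refine memLp_top_of_bound (measurable_mul_extend hw hR hf).aestronglyMeasurable |C| ?_
  filter_upwards [ae_forall_mem_imp_ne_zero μ fun _ : Unit => R] with x hx
  by_cases hxR : x ∈ R
  · rw [extend_val_of_mem hxR, norm_mul, Real.norm_eq_abs, Real.norm_eq_abs,
      abs_of_nonneg (hw_mem x).1]
    exact (mul_le_of_le_one_left (abs_nonneg _) (hw_mem x).2).trans
      ((hC (hx () hxR) _).trans (le_abs_self C))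
  · rw [hw_zero x hxR, zero_mul, norm_zero]
    exact abs_nonneg C

variable {H : Type*} [NormedAddCommGroup H] [InnerProductSpace ℝ H] [RKHS ℝ H R ℝ]
  {L : Y → ℝ → ℝ} {ℓ M κ : ℝ≥0} {lam : ℝ}

lemma IsLocalPredictor.measurable {E : Type*} [MeasurableSpace E] [RKHS ℝ H E ℝ]
    (hm : ∀ f : H, Measurable (f : E → ℝ)) {ν : Measure (E × Y)} {f : E → ℝ}
    (hf : IsLocalPredictor H L lam ν f) : Measurable f := by
  by_cases h : IsProbabilityMeasure ν
  · obtain ⟨g, -, rfl⟩ := hf.1 h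
    exact hm g
  · exact hf.2 h

/-- In a single region, the difference quotients of the local predictors converge uniformly to a
bounded function, provided that the region has positive mass. -/
theorem exists_regional_limit [CompleteSpace H] [IsFiniteMeasure P] (hR : MeasurableSet R)
    (hL : SmoothLoss L ℓ M) (hκ : ∀ (f : H) x, |f x| ≤ κ * ‖f‖) (hm : ∀ f : H, Measurable f)
    (hlam : 0 < lam) {S : Measure (R × Y) → R → ℝ} (hS : ∀ ν, IsLocalPredictor H L lam ν (S ν))
    (z : X × Y) :
    ∃ G : R → ℝ, Measurable G ∧ (∀ x, |G x| ≤ lam⁻¹ * κ ^ 2 * ℓ) ∧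
      ∃ c : ℝ → ℝ, Tendsto c (𝓝[>] 0) (𝓝 0) ∧ ∀ ε ∈ Ioc (0 : ℝ) 1, P.fst R ≠ 0 →
        ∀ x, |(S (contaminatedLaw P R z ε) x - S (regionalLaw P R) x) / ε - G x| ≤ c ε := by
  -- Otherwise the limit 0 works: if `z.1 ∉ R` the law is not contaminated and the quotient is 0; if
  -- `R` is null the estimate is vacuous.
  by_cases h : P.fst R ≠ 0 ∧ z.1 ∈ R
  · obtain ⟨hP, hz⟩ := h
    have := isProbabilityMeasure_regionalLaw hR hP
    obtain ⟨f₀, hf₀, hS₀⟩ := (hS (regionalLaw P R)).1 this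
    have hex : ∀ ε : ℝ, ∃ f : H, ε ∈ Ioc (0 : ℝ) 1 →
        IsSVM L lam (contaminatedLaw P R z ε) f ∧ S (contaminatedLaw P R z ε) = f := fun ε => by
      by_cases hε : ε ∈ Ioc (0 : ℝ) 1
      · obtain ⟨f, hf⟩ := (hS (contaminatedLaw P R z ε)).1
          (isProbabilityMeasure_contaminatedLaw hR hP z ⟨hε.1.le, hε.2⟩)
        exact ⟨f, fun _ => hf⟩
      · exact ⟨0, fun h => absurd h hε⟩
    choose f hf using hex
    obtain ⟨g, hg, hlim⟩ := exists_tendsto_mixture (f := f) hL hκ hm hlam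
      (fun ε hε => contaminatedLaw_of_mem (P := P) hz ε ▸ (hf ε hε).1) hf₀
    refine ⟨g, hm g, fun x => ?_, fun ε => κ * ‖ε⁻¹ • (f ε - f₀) - g‖, ?_, fun ε hε _ x => ?_⟩
    · refine (hκ g x).trans ((mul_le_mul_of_nonneg_left hg κ.coe_nonneg).trans (le_of_eq ?_))
      rw [div_eq_inv_mul]
      ring
    · simpa using (tendsto_iff_norm_sub_tendsto_zero.1 hlim).const_mul (κ : ℝ)
    · refine (le_of_eq ?_).trans (hκ _ x)
      rw [(hf ε hε).2, hS₀]
      simp only [RKHS.coe_sub, RKHS.coe_smul, Pi.sub_apply, Pi.smul_apply, smul_eq_mul]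
      rw [div_eq_inv_mul]
  · refine ⟨0, measurable_const, fun x => ?_, 0, tendsto_const_nhds, fun ε _ hP x => ?_⟩
    · simp only [Pi.zero_apply, abs_zero]
      positivity
    · rw [contaminatedLaw_of_notMem fun hz => h ⟨hP, hz⟩]
      simp

end Region

/-! ### Gluing the regional limits and uniqueness of the influence function. -/

section Composition

variable {X Y : Type*} [MeasurableSpace X] [MeasurableSpace Y] {B : ℕ} {R : Fin B → Set X}
  {w : Fin B → X → ℝ}

omit [MeasurableSpace X] in
lemma abs_composed_le (hw_nonneg : ∀ b x, 0 ≤ w b x) (hw_zero : ∀ b, ∀ x ∉ R b, w b x = 0)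
    {f : ∀ b, R b → ℝ} {v c : Fin B → ℝ} {x : X} (hv : ∀ b, x ∈ R b → w b x ≤ v b)
    (hv0 : ∀ b, 0 ≤ v b) (hc : ∀ b (hx : x ∈ R b), |f b ⟨x, hx⟩| ≤ c b) (hc0 : ∀ b, 0 ≤ c b) :
    |composed w f x| ≤ ∑ b, v b * c b := by
  refine (Finset.abs_sum_le_sum_abs _ _).trans (Finset.sum_le_sum fun b _ => ?_)
  by_cases hx : x ∈ R b
  · rw [extend_val_of_mem hx, abs_mul, abs_of_nonneg (hw_nonneg b x)]
    exact mul_le_mul (hv b hx) (hc b hx) (abs_nonneg _) (hv0 b)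
  · rw [hw_zero b x hx, zero_mul, abs_zero]
    exact mul_nonneg (hv0 b) (hc0 b)

omit [MeasurableSpace X] in
lemma composed_sub_div_sub (hw_zero : ∀ b, ∀ x ∉ R b, w b x = 0) (f f₀ g : ∀ b, R b → ℝ) (ε : ℝ)
    (x : X) : (composed w f x - composed w f₀ x) / ε - composed w g x =
      composed w (fun b x => (f b x - f₀ b x) / ε - g b x) x := by
  simp only [composed]
  rw [← Finset.sum_sub_distrib, Finset.sum_div, ← Finset.sum_sub_distrib]
  refine Finset.sum_congr rfl fun b _ => ?_
  by_cases hx : x ∈ R b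
  · simp only [extend_val_of_mem hx]
    ring
  · simp [hw_zero b x hx]

lemma memLp_composed (hw : ∀ b, Measurable (w b)) (hw_mem : ∀ b x, w b x ∈ Icc (0 : ℝ) 1)
    (hw_zero : ∀ b, ∀ x ∉ R b, w b x = 0) (hR : ∀ b, MeasurableSet (R b)) {μ : Measure X}
    {f : ∀ b, R b → ℝ} (hf : ∀ b, Measurable (f b))
    (hb : ∀ b, μ (R b) ≠ 0 → ∃ C, ∀ x, |f b x| ≤ C) : MemLp (composed w f) ∞ μ :=
  memLp_finsetSum Finset.univ fun b _ =>
    memLp_mul_extend (hw b) (hw_mem b) (hw_zero b) (hR b) (hf b) (hb b)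

/-- The influence function is unique up to null sets. -/
lemma IsInfluenceFunction.eLpNorm_eq {S : ∀ b, Measure (R b × Y) → R b → ℝ}
    {P : Measure (X × Y)} {z : X × Y} {G G' : X → ℝ} (hG : IsInfluenceFunction w S P z G)
    (hG' : IsInfluenceFunction w S P z G') : eLpNorm G ∞ P.fst = eLpNorm G' ∞ P.fst := by
  have h0 : eLpNorm (G' - G) ∞ P.fst ≤ 0 := by
    have h1 := hG.2.add hG'.2
    rw [add_zero] at h1
    -- The distance of `G` and `G'` does not depend on ε and is at most the sum of the two
    -- approximation errors, which tends to 0.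
    refine ge_of_tendsto' h1 fun ε => ?_
    set q : X → ℝ := fun x =>
      (contaminatedPredictor w S P z ε x - composedPredictor w S P x) / ε
    have h2 : G' - G = (fun x => q x - G x) + fun x => -(q x - G' x) := by
      ext x
      simp only [Pi.sub_apply, Pi.add_apply]
      ring
    rw [h2, eLpNorm_exponent_top]
    refine eLpNormEssSup_add_le.trans (le_of_eq ?_)
    rw [← eLpNorm_exponent_top, ← eLpNorm_exponent_top]
    congr 1
    exact eLpNorm_neg (fun x => q x - G' x) _ _
  have h1 := (eLpNorm_eq_zero_iff (hG'.1.sub hG.1).aestronglyMeasurable ENNReal.top_ne_zero).1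
    (le_antisymm h0 zero_le)
  refine (eLpNorm_congr_ae ?_).symm
  filter_upwards [h1] with x hx
  exact sub_eq_zero.1 hx

end Composition

lemma SmoothLoss.of_iSup_lt_top {Y : Type*} [MeasurableSpace Y] {L : Y → ℝ → ℝ} {ℓ : ℝ≥0}
    (hL_meas : Measurable (Function.uncurry L)) (hL_conv : ∀ y, ConvexOn ℝ univ (L y))
    (hL_lip : ∀ y, LipschitzWith ℓ (L y)) (hL_diff : ∀ y, ContDiff ℝ 2 (L y))
    (hL_deriv2 : (⨆ y, ⨆ t, ‖iteratedDeriv 2 (L y) t‖ₑ) < ∞) : ∃ M, SmoothLoss L ℓ M := by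
  refine ⟨(⨆ y, ⨆ t, ‖iteratedDeriv 2 (L y) t‖ₑ).toNNReal, hL_meas, hL_conv, hL_lip, hL_diff,
    fun y t => ?_⟩
  have h1 : ‖iteratedDeriv 2 (L y) t‖ₑ ≤ ⨆ y, ⨆ t, ‖iteratedDeriv 2 (L y) t‖ₑ :=
    le_iSup₂_of_le y t le_rfl
  rw [iteratedDeriv_succ, iteratedDeriv_one] at h1
  have h2 := ENNReal.toNNReal_mono hL_deriv2.ne h1
  rw [toNNReal_enorm] at h2
  exact h2

end LocalSVM

/-! ### The composed predictor. -/

theorem theorem3p4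
    {X : Type*} [MetricSpace X] [TopologicalSpace.SeparableSpace X]
    [MeasurableSpace X] [BorelSpace X]
    (Y : Set ℝ) (hY : IsClosed Y)
    -- regions, covering `X`
    (B : ℕ) (R : Fin B → Set X) (hR : ∀ b, IsComplete (R b)) (hcover : ⋃ b, R b = univ)
    -- weights
    (w : Fin B → X → ℝ) (hw_meas : ∀ b, Measurable (w b))
    (hw_mem : ∀ b x, w b x ∈ Icc (0 : ℝ) 1)
    (hw_sum : ∀ x, ∑ b, w b x = 1) (hw_zero : ∀ b, ∀ x ∉ R b, w b x = 0)
    -- regularization parameters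
    (lam : Fin B → ℝ) (hlam : ∀ b, 0 < lam b)
    -- local reproducing kernel Hilbert spaces with bounded and continuous kernels
    (H : Fin B → Type*) [∀ b, NormedAddCommGroup (H b)] [∀ b, InnerProductSpace ℝ (H b)]
    [∀ b, CompleteSpace (H b)] [∀ b, RKHS ℝ (H b) (R b) ℝ]
    (hk_bdd : ∀ b, BddAbove (range fun x : R b => √(LocalSVM.scalarKernel (H b) x x)))
    (hk_cont : ∀ b, Continuous fun p : R b × R b => LocalSVM.scalarKernel (H b) p.1 p.2)
    -- the loss function, with Lipschitz constant `ℓ`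
    (L : Y → ℝ → ℝ) (hL_nonneg : ∀ y t, 0 ≤ L y t)
    (hL_meas : Measurable (Function.uncurry L))
    (hL_conv : ∀ y, ConvexOn ℝ univ (L y))
    (ℓ : ℝ≥0) (hL_lip : ∀ y, LipschitzWith ℓ (L y))
    (hL_diff : ∀ y, ContDiff ℝ 2 (L y))
    (hL_deriv : (⨆ y, ⨆ t, ‖deriv (L y) t‖ₑ) ∈ Ioo (0 : ℝ≥0∞) ∞)
    (hL_deriv2 : (⨆ y, ⨆ t, ‖iteratedDeriv 2 (L y) t‖ₑ) < ∞) :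
    -- the local SVMs exist and are unique
    (∀ b, ∀ ν : Measure (R b × Y), IsProbabilityMeasure ν →
      ∃! h : H b, LocalSVM.IsSVM L (lam b) ν h) ∧
    -- for all local statistical operators, all laws `P` and all points `z`
    ∀ S : ∀ b, Measure (R b × Y) → R b → ℝ,
      (∀ b ν, LocalSVM.IsLocalPredictor (H b) L (lam b) ν (S b ν)) →
      ∀ P : Measure (X × Y), IsProbabilityMeasure P → ∀ z : X × Y,
        -- the composed predictors belong to `L^∞(P^X)`,
        MemLp (LocalSVM.composedPredictor w S P) ∞ P.fst ∧
        (∀ ε ∈ Ioc (0 : ℝ) 1, MemLp (LocalSVM.contaminatedPredictor w S P z ε) ∞ P.fst) ∧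
        -- the influence function exists,
        (∃ G, LocalSVM.IsInfluenceFunction w S P z G) ∧
        -- and it satisfies the bound
        ∀ G, LocalSVM.IsInfluenceFunction w S P z G →
          eLpNorm G ∞ P.fst ≤ ENNReal.ofReal
            (2 * ℓ * ∑ b, (⨆ x : R b, w b x) * (lam b)⁻¹ * LocalSVM.kernelNorm (H b) ^ 2) := by
  -- Complete subsets of a metric space are closed, hence Borel.
  have hRm : ∀ b, MeasurableSet (R b) := fun b => (hR b).isClosed.measurableSet
  obtain ⟨M, hL⟩ := LocalSVM.SmoothLoss.of_iSup_lt_top hL_meas hL_conv hL_lip hL_diff hL_deriv2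
  let κ : Fin B → ℝ≥0 := fun b => ⟨LocalSVM.kernelNorm (H b), LocalSVM.kernelNorm_nonneg⟩
  have hκ : ∀ b (f : H b) x, |f x| ≤ κ b * ‖f‖ := fun b => LocalSVM.abs_apply_le (hk_bdd b)
  have hm : ∀ b (f : H b), Measurable f := fun b f =>
    (LocalSVM.continuous_of_continuous_kernel (hk_cont b) f).measurable
  refine ⟨fun b ν hν => LocalSVM.existsUnique_isSVM hL (hκ b) (hm b) (hlam b), ?_⟩
  intro S hS P hP z
  have hbdd : ∀ b (ν : Measure (R b × Y)), IsProbabilityMeasure ν → ∃ C, ∀ x, |S b ν x| ≤ C :=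
    fun b ν hν => by
      obtain ⟨f, -, hf⟩ := (hS b ν).1 hν
      exact ⟨κ b * ‖f‖, fun x => hf ▸ hκ b f x⟩
  have hmeas := fun b ν => (hS b ν).measurable (hm b)
  choose G hGm hGb c hc hGc using fun b =>
    LocalSVM.exists_regional_limit (P := P) (hRm b) hL (hκ b) (hm b) (hlam b) (hS b) z
  set v : Fin B → ℝ := fun b => ⨆ x : R b, w b x
  have hv0 : ∀ b, 0 ≤ v b := fun b => Real.iSup_nonneg fun x => (hw_mem b x).1
  have hv : ∀ b x, x ∈ R b → w b x ≤ v b := fun b x hx =>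
    le_ciSup (f := fun x : R b => w b x) ⟨1, by rintro _ ⟨x, rfl⟩; exact (hw_mem b x).2⟩ ⟨x, hx⟩
  have hGle : ∀ x, |LocalSVM.composed w G x| ≤
      ∑ b, v b * ((lam b)⁻¹ * LocalSVM.kernelNorm (H b) ^ 2 * ℓ) := fun x =>
    LocalSVM.abs_composed_le (fun b x => (hw_mem b x).1) hw_zero (fun b hx => hv b x hx) hv0
      (fun b hx => hGb b ⟨x, hx⟩) fun b => by have := hlam b; positivity
  have hIF : LocalSVM.IsInfluenceFunction w S P z (LocalSVM.composed w G) := by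
    refine ⟨LocalSVM.memLp_composed hw_meas hw_mem hw_zero hRm hGm fun b _ => ⟨_, hGb b⟩, ?_⟩
    have hlim : Tendsto (fun ε => ENNReal.ofReal (∑ b, 1 * |c b ε|)) (𝓝[>] 0) (𝓝 0) := by
      rw [← ENNReal.ofReal_zero, ← Finset.sum_const_zero (ι := Fin B) (s := Finset.univ)]
      refine ENNReal.tendsto_ofReal (tendsto_finsetSum _ fun b _ => ?_)
      simpa using (hc b).abs
    refine tendsto_of_tendsto_of_tendsto_of_le_of_le' tendsto_const_nhds hlim
      (.of_forall fun _ => zero_le) ?_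
    filter_upwards [Ioc_mem_nhdsGT (one_pos (α := ℝ))] with ε hε
    rw [eLpNorm_exponent_top]
    refine eLpNormEssSup_le_of_ae_bound ?_
    filter_upwards [LocalSVM.ae_forall_mem_imp_ne_zero P.fst R] with x hx
    rw [LocalSVM.contaminatedPredictor, LocalSVM.composedPredictor,
      LocalSVM.composed_sub_div_sub hw_zero]
    -- Only convergence matters here, so the weights are bounded by 1; the suprema `v b` are needed
    -- only for the norm of the limit.
    exact LocalSVM.abs_composed_le (fun b x => (hw_mem b x).1) hw_zero
      (fun b _ => (hw_mem b x).2) (fun _ => zero_le_one)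
      (fun b hxb => (hGc b ε hε (hx b hxb) _).trans (le_abs_self _)) fun b => abs_nonneg _
  refine ⟨?_, fun ε hε => ?_, ⟨_, hIF⟩, fun G' hG' => ?_⟩
  · exact LocalSVM.memLp_composed hw_meas hw_mem hw_zero hRm (fun b => hmeas b _) fun b hb =>
      hbdd b _ (LocalSVM.isProbabilityMeasure_regionalLaw (hRm b) hb)
  · exact LocalSVM.memLp_composed hw_meas hw_mem hw_zero hRm (fun b => hmeas b _) fun b hb =>
      hbdd b _ (LocalSVM.isProbabilityMeasure_contaminatedLaw (hRm b) hb z ⟨hε.1.le, hε.2⟩)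
  · rw [hG'.eLpNorm_eq hIF, eLpNorm_exponent_top]
    refine eLpNormEssSup_le_of_ae_bound (.of_forall fun x => (hGle x).trans ?_)
    have h1 : ∑ b, v b * ((lam b)⁻¹ * LocalSVM.kernelNorm (H b) ^ 2 * ℓ) =
        ℓ * ∑ b, v b * (lam b)⁻¹ * LocalSVM.kernelNorm (H b) ^ 2 := by
      rw [Finset.mul_sum]
      exact Finset.sum_congr rfl fun b _ => by ring
    -- The bound obtained is half of the one claimed; nonnegativity allows doubling it.
    have h2 : 0 ≤ ℓ * ∑ b, v b * (lam b)⁻¹ * LocalSVM.kernelNorm (H b) ^ 2 :=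
      mul_nonneg ℓ.2 (Finset.sum_nonneg fun b _ =>
        mul_nonneg (mul_nonneg (hv0 b) (inv_nonneg.2 (hlam b).le)) (sq_nonneg _))
    rw [h1, mul_assoc]
    linarith
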